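/- Fix a countable set $\mathbb P$ of propositional variables and let ${\sf L}$ be the language $$\varphi,\psi ::= p \mid \bot \mid \varphi\wedge\psi \mid \varphi\vee\psi \mid \varphi\to\psi \mid \bigcirc\varphi \mid \Diamond\varphi \mid \Box\varphi \mid \varphi\,{\sf U}\,\psi \mid \varphi\,{\sf R}\,\psi \qquad (p\in\mathbb P).$$ The length $|\varphi|$ is the number of occurrences of connectives in $\varphi$ (with $|p|=|\bot|=0$). A dynamic poset is a triple $(W,\preccurlyeq,S)$ where $W$ is a non-empty set, $\preccurlyeq$ is a partial order on $W$, and $S\colon W\to W$ satisfies $w\preccurlyeq v\Rightarrow S(w)\preccurlyeq S(v)$. A model $M=(W,\preccurlyeq,S,V)$ is a dynamic poset with a valuation $V\colon W\to\mathcal P(\mathbb P)$ such that $w\preccurlyeq v\Rightarrow V(w)\subseteq V(v)$. Truth at a world is defined as follows: $M,w\models p$ iff $p\in V(w)$; $M,w\not\models\bot$; $\wedge$ and $\vee$ are evaluated pointwise; $M,w\models\varphi\to\psi$ iff for all $v\succcurlyeq w$, $M,v\models\varphi$ implies $M,v\models\psi$; $M,w\models\bigcirc\varphi$ iff $M,S(w)\models\varphi$;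 $M,w\models\Diamond\varphi$ (resp. $\Box\varphi$) iff $M,S^k(w)\models\varphi$ for some (resp. every) $k\ge 0$; $M,w\models\varphi\,{\sf U}\,\psi$ iff there is $k\ge0$ with $M,S^k(w)\models\psi$ and $M,S^i(w)\models\varphi$ for all $0\le i<k$; $M,w\models\varphi\,{\sf R}\,\psi$ iff for all $k\ge0$, $M,S^k(w)\models\psi$ or there is $0\le i<k$ with $M,S^i(w)\models\varphi$. A formula is satisfied (resp. falsified) in $M$ if it is true (resp. not true) at some world of $M$, and it is satisfiable (resp. falsifiable) if it is satisfied (resp. falsified) in some model. **Theorem** (effective finite model property of ${\sf ITL^e}$). There is a computable function $B\colon\mathbb N\to\mathbb N$, independent of $\mathbb P$, such that for every formula $\varphi\in{\sf L}$: 1. $\varphi$ is satisfiable if and only if it is satisfied in some model $(W,\preccurlyeq,S,V)$ with $W$ finite and $|W|\le B(|\varphi|)$; 2. $\varphi$ is falsifiable if and only if it is falsified in some model $(W,\preccurlyeq,S,V)$ with $W$ finite and $|W|\le B(|\varphi|)$. -/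

import Mathlib

universe u v

namespace ITL

/-- Formulas of the full language `L` over a set `P` of propositional variables.
Negation is the abbreviation `φ → ⊥`. -/
inductive Formula (P : Type v) : Type v where
  | var : P → Formula P
  | bot : Formula P
  | and : Formula P → Formula P → Formula P
  | or : Formula P → Formula P → Formula P
  | imp : Formula P → Formula P → Formula P
  | next : Formula P → Formula P
  | eventually : Formula P → Formula P
  | henceforth : Formula P → Formula P
  | until : Formula P → Formula P → Formula P
  | release : Formula P → Formula P → Formula P

/-- The length of a formula: the number of occurrences of connectives in it. -/
def Formula.length {P : Type v} : Formula P → ℕ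
  | .var _ => 0
  | .bot => 0
  | .and φ ψ => 1 + φ.length + ψ.length
  | .or φ ψ => 1 + φ.length + ψ.length
  | .imp φ ψ => 1 + φ.length + ψ.length
  | .next φ => 1 + φ.length
  | .eventually φ => 1 + φ.length
  | .henceforth φ => 1 + φ.length
  | .until φ ψ => 1 + φ.length + ψ.length
  | .release φ ψ => 1 + φ.length + ψ.length

/-- A dynamic poset: a non-empty partially ordered set of worlds with a forward confluent
(that is, order-preserving) successor function. -/
structure DynamicPoset : Type (u + 1) where
  World : Type u
  [nonempty : Nonempty World]
  [order : PartialOrder World]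
  succ : World → World
  confluent : ∀ w v : World, w ≤ v → succ w ≤ succ v

attribute [instance] DynamicPoset.nonempty DynamicPoset.order

/-- An intuitionistic dynamic model: a dynamic poset with a monotone valuation. -/
structure Model (P : Type v) : Type (max (u + 1) v) extends DynamicPoset.{u} where
  val : World → Set P
  val_mono : ∀ w v : World, w ≤ v → val w ⊆ val v

/-- The satisfaction relation `M, w ⊨ φ`. -/
def Model.Sat {P : Type v} (M : Model.{u, v} P) : M.World → Formula P → Prop
  | w, .var p => p ∈ M.val w
  | _, .bot => False
  | w, .and φ ψ => M.Sat w φ ∧ M.Sat w ψ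
  | w, .or φ ψ => M.Sat w φ ∨ M.Sat w ψ
  | w, .imp φ ψ => ∀ v : M.World, w ≤ v → M.Sat v φ → M.Sat v ψ
  | w, .next φ => M.Sat (M.succ w) φ
  | w, .eventually φ => ∃ k : ℕ, M.Sat (M.succ^[k] w) φ
  | w, .henceforth φ => ∀ k : ℕ, M.Sat (M.succ^[k] w) φ
  | w, .until φ ψ => ∃ k : ℕ, M.Sat (M.succ^[k] w) ψ ∧ ∀ i < k, M.Sat (M.succ^[i] w) φ
  | w, .release φ ψ => ∀ k : ℕ, M.Sat (M.succ^[k] w) ψ ∨ ∃ i < k, M.Sat (M.succ^[i] w) φ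

/-- `φ` is satisfied in `M`: it holds at some world of `M`. -/
def Model.Satisfies {P : Type v} (M : Model.{u, v} P) (φ : Formula P) : Prop :=
  ∃ w : M.World, M.Sat w φ

/-- `φ` is falsified in `M`: it fails at some world of `M`. -/
def Model.Falsifies {P : Type v} (M : Model.{u, v} P) (φ : Formula P) : Prop :=
  ∃ w : M.World, ¬ M.Sat w φ

/-- `φ` is satisfiable over the class of all intuitionistic dynamic models. -/
def Formula.Satisfiable {P : Type v} (φ : Formula P) : Prop :=
  ∃ M : Model.{u, v} P, M.Satisfies φ

/-- `φ` is falsifiable, that is, not valid, over the class of all intuitionistic dynamic models. -/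
def Formula.Falsifiable {P : Type v} (φ : Formula P) : Prop :=
  ∃ M : Model.{u, v} P, M.Falsifies φ

end ITL

/-! Fix a family of k formulas that contains φ and is closed under subformulas, and label each world
by the members true there. Labels grow along the order, so a chain with strictly growing labels has
at most k steps, and above each world lies a tree of such chains. Up to bisimulation these trees
have finitely many types (`TreeType`). Keeping one chosen world for each type at each choice leaves
finitely many trees of bounded size (`treeCover`).

The successor function induces monotone maps between these trees that respect labels (`treeHom`).
Fixing one map per tree might postpone an eventuality forever, but a map can be made to follow a
given chain of the original model, so each single eventuality is fulfilled along some sequence of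
maps (`treeCover_reach`). As trees are finite, all pending eventualities of a tree can be fulfilled
by a common sequence (`Fair.exists_dischargedIn`), and a strategy that remembers only the tree and
the set of unpaid debts achieves this (`Fair.nonempty_strategy`). Its states paired with tree nodes
form the finite model, and a truth lemma (`Strategy.sat_model_iff`) transfers every formula of the
family. The size is bounded by a primitive recursive function of k = 2|φ| + 1. -/

namespace ITL

variable {P : Type v}

/-! ### Families of formulas closed under subformulas -/

/-- The list of subformulas of a formula, with repetitions. -/
def Formula.subformulas : Formula P → List (Formula P)
  | .var p => [.var p]
  | .bot => [.bot]
  | .and φ ψ => .and φ ψ :: (φ.subformulas ++ ψ.subformulas)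
  | .or φ ψ => .or φ ψ :: (φ.subformulas ++ ψ.subformulas)
  | .imp φ ψ => .imp φ ψ :: (φ.subformulas ++ ψ.subformulas)
  | .next φ => .next φ :: φ.subformulas
  | .eventually φ => .eventually φ :: φ.subformulas
  | .henceforth φ => .henceforth φ :: φ.subformulas
  | .until φ ψ => .until φ ψ :: (φ.subformulas ++ ψ.subformulas)
  | .release φ ψ => .release φ ψ :: (φ.subformulas ++ ψ.subformulas)

theorem Formula.self_mem_subformulas (φ : Formula P) : φ ∈ φ.subformulas := by
  cases φ <;> simp [Formula.subformulas]

theorem Formula.subformulas_trans (φ : Formula P) :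
    ∀ ψ ∈ φ.subformulas, ∀ χ ∈ ψ.subformulas, χ ∈ φ.subformulas := by
  induction φ with
  | var | bot =>
    intro ψ hψ
    simp only [subformulas, List.mem_singleton] at hψ
    subst hψ
    exact fun _ h => h
  | next a iha | eventually a iha | henceforth a iha =>
    intro ψ hψ χ hχ
    simp only [subformulas, List.mem_cons] at hψ
    rcases hψ with rfl | h
    · exact hχ
    · simp [subformulas, iha ψ h χ hχ]
  | _ a b iha ihb =>
    intro ψ hψ χ hχ
    simp only [subformulas, List.mem_cons, List.mem_append] at hψ
    rcases hψ with rfl | h | h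
    · exact hχ
    · simp [subformulas, iha ψ h χ hχ]
    · simp [subformulas, ihb ψ h χ hχ]

/-- Connectives have at most two arguments, so a syntax tree with n inner nodes has at most n + 1
leaves. -/
theorem Formula.length_subformulas_le (φ : Formula P) :
    φ.subformulas.length ≤ 2 * φ.length + 1 := by
  induction φ <;> simp only [subformulas, length, List.length_cons, List.length_append,
    List.length_nil] <;> omega

/-- A family of formulas is closed if its range contains all subformulas of its members. -/
def ClosedFamily {k : ℕ} (σ : Fin k → Formula P) : Prop :=
  ∀ i, ∀ ψ ∈ (σ i).subformulas, ψ ∈ Set.range σ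

/-- The subformulas of `φ`, padded with `⊥`. -/
def Formula.subformulaFamily (φ : Formula P) (i : Fin (2 * φ.length + 1)) : Formula P :=
  φ.subformulas.getD i .bot

theorem Formula.mem_range_subformulaFamily {φ ψ : Formula P} (h : ψ ∈ φ.subformulas) :
    ψ ∈ Set.range φ.subformulaFamily := by
  obtain ⟨n, hn, rfl⟩ := List.mem_iff_getElem.1 h
  exact ⟨⟨n, hn.trans_le φ.length_subformulas_le⟩, by simp [subformulaFamily, hn]⟩

theorem Formula.closedFamily_subformulaFamily (φ : Formula P) :
    ClosedFamily φ.subformulaFamily := by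
  intro i ψ hψ
  rcases lt_or_ge (i : ℕ) φ.subformulas.length with h | h
  · refine mem_range_subformulaFamily (φ.subformulas_trans _ ?_ ψ hψ)
    simp [subformulaFamily, h]
  · have e : φ.subformulaFamily i = .bot := by simp [subformulaFamily, h]
    rw [e] at hψ
    simp only [subformulas, List.mem_singleton] at hψ
    exact ⟨i, by rw [e, hψ]⟩

/-! ### Eventualities, one-step unfoldings and labels -/

namespace Model

variable (M : Model.{u, v} P)

/-- Eventualities: formulas whose truth (or falsity) promises a future event. -/
def Pending : Formula P → M.World → Prop
  | .eventually φ, w => M.Sat w (.eventually φ)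
  | .henceforth φ, w => ¬ M.Sat w (.henceforth φ)
  | .until φ ψ, w => M.Sat w (.until φ ψ)
  | .release φ ψ, w => ¬ M.Sat w (.release φ ψ)
  | _, _ => False

/-- The event promised by an eventuality happens now. -/
def Fulfilled : Formula P → M.World → Prop
  | .eventually φ, w => M.Sat w φ
  | .henceforth φ, w => ¬ M.Sat w φ
  | .until _ ψ, w => M.Sat w ψ
  | .release _ ψ, w => ¬ M.Sat w ψ
  | _, _ => True

variable {M}

theorem sat_eventually_iff {w : M.World} {φ : Formula P} :
    M.Sat w (.eventually φ) ↔ M.Sat w φ ∨ M.Sat (M.succ w) (.eventually φ) := by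
  simp only [Sat]
  constructor
  · rintro ⟨_ | n, h⟩
    · exact .inl h
    · exact .inr ⟨n, h⟩
  · rintro (h | ⟨n, h⟩)
    · exact ⟨0, h⟩
    · exact ⟨n + 1, h⟩

theorem sat_henceforth_iff {w : M.World} {φ : Formula P} :
    M.Sat w (.henceforth φ) ↔ M.Sat w φ ∧ M.Sat (M.succ w) (.henceforth φ) := by
  simp only [Sat]
  constructor
  · exact fun h => ⟨h 0, fun n => h (n + 1)⟩
  · rintro ⟨h, h'⟩ (_ | n)
    · exact h
    · exact h' n

theorem sat_until_iff {w : M.World} {φ ψ : Formula P} :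
    M.Sat w (.until φ ψ) ↔ M.Sat w ψ ∨ M.Sat w φ ∧ M.Sat (M.succ w) (.until φ ψ) := by
  simp only [Sat]
  constructor
  · rintro ⟨_ | n, h, h'⟩
    · exact .inl h
    · exact .inr ⟨h' 0 n.succ_pos, n, h, fun i hi => h' (i + 1) (by omega)⟩
  · rintro (h | ⟨h, n, h1, h2⟩)
    · exact ⟨0, h, by simp⟩
    · refine ⟨n + 1, h1, ?_⟩
      rintro (_ | i) hi
      · exact h
      · exact h2 i (by omega)

theorem sat_release_iff {w : M.World} {φ ψ : Formula P} :
    M.Sat w (.release φ ψ) ↔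
      M.Sat w ψ ∧ (M.Sat w φ ∨ M.Sat (M.succ w) (.release φ ψ)) := by
  simp only [Sat]
  constructor
  · intro h
    refine ⟨by simpa using h 0, or_iff_not_imp_left.2 fun hφ n => ?_⟩
    rcases h (n + 1) with h' | ⟨_ | i, hi, h'⟩
    · exact .inl h'
    · exact absurd h' hφ
    · exact .inr ⟨i, by omega, h'⟩
  · rintro ⟨h, h'⟩ (_ | n)
    · exact .inl h
    · rcases h' with h' | h'
      · exact .inr ⟨0, n.succ_pos, h'⟩
      · rcases h' n with h1 | ⟨i, hi, h1⟩
        · exact .inl h1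
        · exact .inr ⟨i + 1, by omega, h1⟩

theorem Pending.step {φ : Formula P} {w : M.World} (h : M.Pending φ w) :
    M.Fulfilled φ w ∨ M.Pending φ (M.succ w) := by
  cases φ with
  | eventually φ => exact sat_eventually_iff.1 h
  | henceforth φ =>
    simp only [Pending, Fulfilled] at *
    rw [sat_henceforth_iff] at h
    tauto
  | release φ ψ =>
    simp only [Pending, Fulfilled] at *
    rw [sat_release_iff] at h
    tauto
  | var | bot | and | or | imp | next => exact h.elim
  | _ φ ψ =>
    simp only [Pending, Fulfilled] at *
    rw [sat_until_iff] at h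
    tauto

/-- The side conditions of `until` and `release` are dropped here; the truth lemma recovers them
from the one-step unfoldings. -/
theorem Pending.exists_fulfilled {φ : Formula P} {w : M.World} (h : M.Pending φ w) :
    ∃ n, M.Fulfilled φ (M.succ^[n] w) := by
  cases φ with
  | eventually φ => exact h
  | henceforth φ => simpa [Pending, Fulfilled, Sat] using h
  | release φ ψ =>
    simp only [Pending, Sat, not_forall, not_or] at h
    obtain ⟨n, h, -⟩ := h
    exact ⟨n, h⟩
  | var | bot | and | or | imp | next => exact h.elim
  | _ φ ψ => obtain ⟨n, h, -⟩ := h; exact ⟨n, h⟩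

theorem Sat.mono {φ : Formula P} : ∀ {w w' : M.World}, w ≤ w' → M.Sat w φ → M.Sat w' φ := by
  have hS : ∀ (n : ℕ) {w w' : M.World}, w ≤ w' → M.succ^[n] w ≤ M.succ^[n] w' := fun n _ _ h =>
    (show Monotone M.succ from fun a b h => M.confluent a b h).iterate n h
  induction φ with
  | var p => exact fun h hw => M.val_mono _ _ h hw
  | bot => exact fun _ h => h
  | and a b iha ihb => exact fun h hw => ⟨iha h hw.1, ihb h hw.2⟩
  | or a b iha ihb => exact fun h hw => hw.imp (iha h) (ihb h)
  | imp a b _ _ => exact fun h hw v hv => hw v (h.trans hv)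
  | next a iha => exact fun h hw => iha (M.confluent _ _ h) hw
  | eventually a iha => exact fun h ⟨n, hw⟩ => ⟨n, iha (hS n h) hw⟩
  | henceforth a iha => exact fun h hw n => iha (hS n h) (hw n)
  | release a b iha ihb =>
    exact fun h hw n =>
      (hw n).imp (ihb (hS n h)) fun ⟨i, hi, hw⟩ => ⟨i, hi, iha (hS i h) hw⟩
  | _ a b iha ihb =>
    exact fun h ⟨n, hn, hi⟩ => ⟨n, ihb (hS n h) hn, fun i hin => iha (hS i h) (hi i hin)⟩

variable (M) {k : ℕ} (σ : Fin k → Formula P)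

/-- The indices of the formulas of the family `σ` that hold at `w`. -/
def label (w : M.World) : Set (Fin k) := {i | M.Sat w (σ i)}

variable {M σ}

theorem label_mono {x y : M.World} (h : x ≤ y) : M.label σ x ⊆ M.label σ y :=
  fun _ hi => Sat.mono h hi

theorem sat_iff_of_label_eq {x y : M.World} (h : M.label σ x = M.label σ y) {φ : Formula P}
    (hφ : φ ∈ Set.range σ) : M.Sat x φ ↔ M.Sat y φ := by
  obtain ⟨i, rfl⟩ := hφ
  exact Set.ext_iff.1 h i

theorem pending_iff_of_label_eq {x y : M.World} (h : M.label σ x = M.label σ y) (i : Fin k) :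
    M.Pending (σ i) x ↔ M.Pending (σ i) y := by
  have := sat_iff_of_label_eq h (Set.mem_range_self i)
  revert this
  cases σ i <;> simp +contextual [Pending]

theorem fulfilled_iff_of_label_eq (hσ : ClosedFamily σ) {x y : M.World}
    (h : M.label σ x = M.label σ y) (i : Fin k) :
    M.Fulfilled (σ i) x ↔ M.Fulfilled (σ i) y := by
  have := hσ i
  revert this
  cases σ i <;> intro this <;> simp only [Fulfilled]
  · rename_i a
    exact sat_iff_of_label_eq h (this a (by simp [Formula.subformulas, a.self_mem_subformulas]))
  · rename_i a
    exact not_congr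
      (sat_iff_of_label_eq h (this a (by simp [Formula.subformulas, a.self_mem_subformulas])))
  · rename_i a b
    exact sat_iff_of_label_eq h (this b (by simp [Formula.subformulas, b.self_mem_subformulas]))
  · rename_i a b
    exact not_congr
      (sat_iff_of_label_eq h (this b (by simp [Formula.subformulas, b.self_mem_subformulas])))

end Model

/-! ### Covers, debts and finite-memory strategies -/

/-- A family of posets whose nodes are labelled by worlds of a model `M`, in such a way that labels
grow along the order and every world above the label of a node is matched by a larger node. -/
structure Cover (M : Model.{u, v} P) {k : ℕ} (σ : Fin k → Formula P) : Type (u + 1) where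
  Obj : Type u
  Node : Obj → Type u
  [order : ∀ m, PartialOrder (Node m)]
  pt : ∀ {m}, Node m → M.World
  pt_mono : ∀ {m} {d e : Node m}, d ≤ e → M.label σ (pt d) ⊆ M.label σ (pt e)
  witness : ∀ {m} (d : Node m) (z : M.World), pt d ≤ z →
    ∃ e, d ≤ e ∧ M.label σ (pt e) = M.label σ z

attribute [instance] Cover.order

namespace Cover

variable {M : Model.{u, v} P} {k : ℕ} {σ : Fin k → Formula P} (C : Cover M σ)

/-- A monotone map between posets of a cover that acts on labels as the successor function of `M`
does on some world. -/
structure Hom (m m' : C.Obj) where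
  toFun : C.Node m → C.Node m'
  mono : ∀ {d e}, d ≤ e → toFun d ≤ toFun e
  sensible : ∀ d, ∃ y, M.label σ y = M.label σ (C.pt d) ∧
    M.label σ (M.succ y) = M.label σ (C.pt (toFun d))

/-- The `i`-th eventuality of a node can be fulfilled by a sequence of homomorphisms. -/
inductive Reach (i : Fin k) : ∀ m : C.Obj, C.Node m → Prop
  | now {m d} : M.Fulfilled (σ i) (C.pt d) → Reach i m d
  | step {m m' d} (f : C.Hom m m') : Reach i m' (f.toFun d) → Reach i m d

/-- Every eventuality can be fulfilled. -/
structure Fair : Prop where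
  exists_hom : ∀ m, ∃ m', Nonempty (C.Hom m m')
  reach : ∀ {m} (d : C.Node m) i, M.Pending (σ i) (C.pt d) → C.Reach i m d

/-- The pairs of a node and an eventuality which is pending and not fulfilled at that node. -/
def debts (m : C.Obj) : Set (C.Node m × Fin k) :=
  {x | M.Pending (σ x.2) (C.pt x.1) ∧ ¬ M.Fulfilled (σ x.2) (C.pt x.1)}

/-- A poset of the cover together with a set of debts that are being paid. -/
abbrev Control := Σ m : C.Obj, Set (C.Node m × Fin k)

variable {C}

theorem Hom.pending_step (hσ : ClosedFamily σ) {m m' : C.Obj} (f : C.Hom m m') {d : C.Node m}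
    {i : Fin k} (h : M.Pending (σ i) (C.pt d)) :
    M.Fulfilled (σ i) (C.pt d) ∨ M.Pending (σ i) (C.pt (f.toFun d)) := by
  obtain ⟨y, hy, hy'⟩ := f.sensible d
  rw [← Model.pending_iff_of_label_eq hy] at h
  exact h.step.imp (Model.fulfilled_iff_of_label_eq hσ hy i).1
    (Model.pending_iff_of_label_eq hy' i).1

/-- The debts that remain after applying a homomorphism. -/
def Hom.remaining {m m' : C.Obj} (f : C.Hom m m') (Q : Set (C.Node m × Fin k)) :
    Set (C.Node m' × Fin k) :=
  (Prod.map f.toFun id '' Q) ∩ C.debts m'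

theorem Hom.fulfilled_or_mem_remaining (hσ : ClosedFamily σ) {m m' : C.Obj} (f : C.Hom m m')
    {Q : Set (C.Node m × Fin k)} {d : C.Node m} {i : Fin k} (hQ : Q ⊆ C.debts m)
    (h : (d, i) ∈ Q) :
    M.Fulfilled (σ i) (C.pt (f.toFun d)) ∨ (f.toFun d, i) ∈ f.remaining Q := by
  refine or_iff_not_imp_left.2 fun h' => ⟨⟨_, h, rfl⟩, ?_, h'⟩
  exact (f.pending_step hσ (hQ h).1).resolve_left (hQ h).2

variable (C) in
/-- All debts can be paid in `n` steps. -/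
def DischargedIn : ℕ → C.Control → Prop
  | 0, c => c.2 = ∅
  | n + 1, c => ∃ m', ∃ f : C.Hom c.1 m', DischargedIn n ⟨m', f.remaining c.2⟩

/-- Pay the debts one at a time: the outer induction is on their number, the inner one on a sequence
of maps that pays one chosen debt. The others are carried along by the maps, which can merge debts
but never multiply them. -/
theorem Fair.exists_dischargedIn (hC : C.Fair) [∀ m, Finite (C.Node m)]
    (N : ℕ) : ∀ (m : C.Obj) (Q : Set (C.Node m × Fin k)), Q ⊆ C.debts m → Q.ncard ≤ N →
      ∃ n, C.DischargedIn n ⟨m, Q⟩ := by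
  induction N with
  | zero => exact fun m Q _ h => ⟨0, (Set.ncard_eq_zero (Set.toFinite Q)).1 (by omega)⟩
  | succ N ih =>
    intro m Q hQ hN
    rcases Q.eq_empty_or_nonempty with h | ⟨⟨d, i⟩, hd⟩
    · exact ⟨0, h⟩
    have hr := hC.reach d i (hQ hd).1
    induction hr with
    | now h => exact absurd h (hQ hd).2
    | @step m m' d f _ ih' =>
      have h1 : (Prod.map f.toFun id '' Q).ncard ≤ N + 1 :=
        (Set.ncard_image_le (Set.toFinite Q)).trans hN
      have h2 : f.remaining Q ⊆ Prod.map f.toFun id '' Q := Set.inter_subset_left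
      suffices ∃ n, C.DischargedIn n ⟨m', f.remaining Q⟩ by
        obtain ⟨n, hn⟩ := this
        exact ⟨n + 1, m', f, hn⟩
      by_cases hf : (f.toFun d, i) ∈ f.remaining Q
      · exact ih' _ Set.inter_subset_right ((Set.ncard_le_ncard h2 (Set.toFinite _)).trans h1) hf
      -- The chosen debt has just been paid: its image is no longer a debt, so the count drops
      -- strictly.
      · refine ih m' _ Set.inter_subset_right (Nat.lt_succ_iff.1 (lt_of_lt_of_le ?_ h1))
        exact Set.ncard_lt_ncard
          (Set.ssubset_iff_of_subset h2 |>.2 ⟨(f.toFun d, i), ⟨_, hd, rfl⟩, hf⟩) (Set.toFinite _)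

variable (C) in
/-- The debts to be paid next: those of the control, or all if there are none left. -/
noncomputable def Control.target (c : C.Control) : Set (C.Node c.1 × Fin k) :=
  open Classical in if c.2 ∩ C.debts c.1 = ∅ then C.debts c.1 else c.2 ∩ C.debts c.1

theorem Control.target_subset (c : C.Control) : c.target ⊆ C.debts c.1 := by
  unfold target
  split_ifs
  · exact subset_rfl
  · exact Set.inter_subset_right

variable (C) in
/-- A strategy: a homomorphism for every control, together with a rank that decreases until all
debts are paid. -/
structure Strategy where
  next : C.Control → C.Obj
  hom : ∀ c, C.Hom c.1 (next c)
  rank : C.Control → ℕ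
  rank_lt : ∀ c : C.Control, (c.2 ∩ C.debts c.1).Nonempty →
    rank ⟨next c, (hom c).remaining c.target⟩ < rank c

/-- The rank is the least number of steps that discharges the debts of the control, and the chosen
map is the first move of a shortest discharge. -/
theorem Fair.nonempty_strategy (hC : C.Fair) [∀ m, Finite (C.Node m)] :
    Nonempty C.Strategy := by
  classical
  have hex (c : C.Control) : ∃ n, C.DischargedIn n ⟨c.1, c.2 ∩ C.debts c.1⟩ :=
    hC.exists_dischargedIn _ _ _ Set.inter_subset_right le_rfl
  have hstep (c : C.Control) : ∃ m', ∃ f : C.Hom c.1 m', (c.2 ∩ C.debts c.1).Nonempty →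
      Nat.find (hex ⟨m', f.remaining c.target⟩) < Nat.find (hex c) := by
    by_cases hc : (c.2 ∩ C.debts c.1).Nonempty
    · have hspec := Nat.find_spec (hex c)
      rcases hn : Nat.find (hex c) with _ | n
      · rw [hn] at hspec
        exact absurd hspec hc.ne_empty
      · rw [hn] at hspec
        obtain ⟨m', f, hf⟩ := hspec
        refine ⟨m', f, fun _ => Nat.lt_succ_iff.2 (Nat.find_min' _ ?_)⟩
        have e : c.target = c.2 ∩ C.debts c.1 := if_neg hc.ne_empty
        have e' : f.remaining c.target ∩ C.debts m' = f.remaining c.target :=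
          Set.inter_eq_left.2 Set.inter_subset_right
        simp only [e']
        rw [e]
        exact hf
    · obtain ⟨m', ⟨f⟩⟩ := hC.exists_hom c.1
      exact ⟨m', f, fun h => absurd h hc⟩
  choose next hom h using hstep
  exact ⟨⟨next, hom, fun c => Nat.find (hex c), h⟩⟩

/-! ### The model of a strategy and its truth lemma -/

namespace Strategy

variable [Nonempty C.Obj] [∀ m, Nonempty (C.Node m)] (s : C.Strategy)

/-- The model that results from following a strategy. -/
noncomputable def model : Model.{u, v} P where
  World := Σ c : C.Control, C.Node c.1
  nonempty := by
    obtain ⟨m⟩ := ‹Nonempty C.Obj›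
    obtain ⟨d⟩ := ‹∀ m, Nonempty (C.Node m)› m
    exact ⟨⟨⟨m, ∅⟩, d⟩⟩
  succ w := ⟨⟨s.next w.1, (s.hom w.1).remaining w.1.target⟩, (s.hom w.1).toFun w.2⟩
  confluent := by
    rintro _ _ ⟨c, d, e, h⟩
    exact Sigma.LE.fiber _ _ _ ((s.hom c).mono h)
  -- Along the order of a cover only formulas of the family are known to persist, so all other
  -- variables are made false.
  val w := {p | .var p ∈ Set.range σ ∧ M.Sat (C.pt w.2) (.var p)}
  val_mono := by
    rintro _ _ ⟨c, d, e, h⟩ p ⟨⟨i, hi⟩, hp⟩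
    refine ⟨⟨i, hi⟩, ?_⟩
    rw [← hi] at hp ⊢
    exact C.pt_mono h hp

/-- The world of `M` that labels a world of the model of a strategy. -/
def toWorld (w : s.model.World) : M.World := C.pt (Sigma.snd w)

theorem sensible (w : s.model.World) : ∃ y, M.label σ y = M.label σ (s.toWorld w) ∧
    M.label σ (M.succ y) = M.label σ (s.toWorld (s.model.succ w)) :=
  (s.hom _).sensible _

/-- A debt stays in the current batch until it is paid, and the rank cannot decrease forever. -/
theorem exists_fulfilled_of_mem (hσ : ClosedFamily σ) (i : Fin k) (n : ℕ) :
    ∀ (c : C.Control) (d : C.Node c.1), s.rank c = n → (d, i) ∈ c.2 ∩ C.debts c.1 →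
      ∃ j, M.Fulfilled (σ i) (s.toWorld (s.model.succ^[j] ⟨c, d⟩)) := by
  induction n using Nat.strong_induction_on with
  | _ n ih =>
    intro c d hc hd
    have e : c.target = c.2 ∩ C.debts c.1 := if_neg (Set.Nonempty.ne_empty ⟨_, hd⟩)
    rcases (s.hom c).fulfilled_or_mem_remaining hσ c.target_subset (e ▸ hd) with h | h
    · exact ⟨1, h⟩
    · obtain ⟨j, hj⟩ := ih _ (hc ▸ s.rank_lt c ⟨_, hd⟩) ⟨s.next c, (s.hom c).remaining c.target⟩
        ((s.hom c).toFun d) rfl ⟨h, h.2⟩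
      exact ⟨j + 1, hj⟩

/-- An eventuality outside the current batch waits, with decreasing rank, until that batch is paid.
If it is still unfulfilled then, it enters the next batch, where `exists_fulfilled_of_mem` applies.
-/
theorem exists_fulfilled (hσ : ClosedFamily σ) (i : Fin k) (n : ℕ) :
    ∀ (c : C.Control) (d : C.Node c.1), s.rank c = n → M.Pending (σ i) (C.pt d) →
      ∃ j, M.Fulfilled (σ i) (s.toWorld (s.model.succ^[j] ⟨c, d⟩)) := by
  induction n using Nat.strong_induction_on with
  | _ n ih =>
    intro c d hc hd
    by_cases hf : M.Fulfilled (σ i) (C.pt d)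
    · exact ⟨0, hf⟩
    by_cases hne : (c.2 ∩ C.debts c.1).Nonempty
    · obtain ⟨j, hj⟩ := ih _ (hc ▸ s.rank_lt c hne) ⟨s.next c, (s.hom c).remaining c.target⟩
        ((s.hom c).toFun d) rfl (((s.hom c).pending_step hσ hd).resolve_left hf)
      exact ⟨j + 1, hj⟩
    · have e : c.target = C.debts c.1 := if_pos (Set.not_nonempty_iff_eq_empty.1 hne)
      have hm : (d, i) ∈ c.target := e ▸ ⟨hd, hf⟩
      rcases (s.hom c).fulfilled_or_mem_remaining hσ c.target_subset hm with h | h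
      · exact ⟨1, h⟩
      · obtain ⟨j, hj⟩ := s.exists_fulfilled_of_mem hσ i _
          ⟨s.next c, (s.hom c).remaining c.target⟩ ((s.hom c).toFun d) rfl ⟨h, h.2⟩
        exact ⟨j + 1, hj⟩

theorem exists_fulfilled_of_pending (hσ : ClosedFamily σ) {φ : Formula P} (hφ : φ ∈ Set.range σ)
    {w : s.model.World} (h : M.Pending φ (s.toWorld w)) :
    ∃ j, M.Fulfilled φ (s.toWorld (s.model.succ^[j] w)) := by
  obtain ⟨i, rfl⟩ := hφ
  exact s.exists_fulfilled hσ i _ w.1 w.2 rfl h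

/-- Implication rests on `witness` and `pt_mono`, the next operator on `sensible`. For the other
temporal operators the local unfoldings transfer and `exists_fulfilled_of_pending` rules out endless
postponement. -/
theorem sat_model_iff (hσ : ClosedFamily σ) (φ : Formula P) :
    φ ∈ Set.range σ → ∀ w : s.model.World, s.model.Sat w φ ↔ M.Sat (s.toWorld w) φ := by
  have hsub {φ ψ : Formula P} (h : φ ∈ Set.range σ) (h' : ψ ∈ φ.subformulas) :
      ψ ∈ Set.range σ := by
    obtain ⟨i, rfl⟩ := h
    exact hσ i ψ h'
  induction φ with
  | var p => exact fun h w => ⟨fun h' => h'.2, fun h' => ⟨h, h'⟩⟩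
  | bot => exact fun _ _ => Iff.rfl
  | and a b iha ihb =>
    intro h w
    have ha := hsub h (ψ := a) (by simp [Formula.subformulas, a.self_mem_subformulas])
    have hb := hsub h (ψ := b) (by simp [Formula.subformulas, b.self_mem_subformulas])
    exact and_congr (iha ha w) (ihb hb w)
  | or a b iha ihb =>
    intro h w
    have ha := hsub h (ψ := a) (by simp [Formula.subformulas, a.self_mem_subformulas])
    have hb := hsub h (ψ := b) (by simp [Formula.subformulas, b.self_mem_subformulas])
    exact or_congr (iha ha w) (ihb hb w)
  | imp a b iha ihb =>
    intro h w
    have ha := hsub h (ψ := a) (by simp [Formula.subformulas, a.self_mem_subformulas])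
    have hb := hsub h (ψ := b) (by simp [Formula.subformulas, b.self_mem_subformulas])
    constructor
    · intro hw z hz hza
      obtain ⟨c, d⟩ := w
      obtain ⟨e, hde, he⟩ := C.witness d z hz
      have := hw ⟨c, e⟩ (Sigma.LE.fiber _ _ _ hde)
        ((iha ha _).2 ((Model.sat_iff_of_label_eq he ha).2 hza))
      exact (Model.sat_iff_of_label_eq he hb).1 ((ihb hb _).1 this)
    · rintro hw _ ⟨c, d, e, hde⟩ hea
      obtain ⟨i, hi⟩ := h
      rw [← hi] at hw
      have := C.pt_mono hde hw
      rw [Model.label, Set.mem_ofPred_eq, hi] at this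
      exact (ihb hb _).2 (this _ le_rfl ((iha ha _).1 hea))
  | next a iha =>
    intro h w
    have ha := hsub h (ψ := a) (by simp [Formula.subformulas, a.self_mem_subformulas])
    obtain ⟨y, hy, hy'⟩ := s.sensible w
    rw [← Model.sat_iff_of_label_eq hy h]
    exact (iha ha _).trans (Model.sat_iff_of_label_eq hy' ha).symm
  | eventually a iha =>
    intro h w
    have ha := hsub h (ψ := a) (by simp [Formula.subformulas, a.self_mem_subformulas])
    -- The unfolding holds in `M` at the world `y` given by `sensible`, and labels carry it to `w`
    -- and its successor.
    have hs (w) : M.Sat (s.toWorld w) (.eventually a) ↔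
        M.Sat (s.toWorld w) a ∨ M.Sat (s.toWorld (s.model.succ w)) (.eventually a) := by
      obtain ⟨y, hy, hy'⟩ := s.sensible w
      rw [← Model.sat_iff_of_label_eq hy h, ← Model.sat_iff_of_label_eq hy ha,
        ← Model.sat_iff_of_label_eq hy' h, Model.sat_eventually_iff]
    simp only [Model.Sat, iha ha]
    constructor
    · rintro ⟨j, hj⟩
      induction j generalizing w with
      | zero => exact (hs w).2 (.inl hj)
      | succ j ih => exact (hs w).2 (.inr (ih _ hj))
    · exact fun hw => s.exists_fulfilled_of_pending hσ h hw
  | henceforth a iha =>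
    intro h w
    have ha := hsub h (ψ := a) (by simp [Formula.subformulas, a.self_mem_subformulas])
    have hs (w) : M.Sat (s.toWorld w) (.henceforth a) ↔
        M.Sat (s.toWorld w) a ∧ M.Sat (s.toWorld (s.model.succ w)) (.henceforth a) := by
      obtain ⟨y, hy, hy'⟩ := s.sensible w
      rw [← Model.sat_iff_of_label_eq hy h, ← Model.sat_iff_of_label_eq hy ha,
        ← Model.sat_iff_of_label_eq hy' h, Model.sat_henceforth_iff]
    rw [Model.Sat]
    simp only [iha ha]
    constructor
    · intro hw
      by_contra hn
      obtain ⟨j, hj⟩ := s.exists_fulfilled_of_pending hσ h hn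
      exact hj (hw j)
    · intro hw j
      induction j generalizing w with
      | zero => exact ((hs w).1 hw).1
      | succ j ih => exact ih _ ((hs w).1 hw).2
  | release a b iha ihb =>
    intro h w
    have ha := hsub h (ψ := a) (by simp [Formula.subformulas, a.self_mem_subformulas])
    have hb := hsub h (ψ := b) (by simp [Formula.subformulas, b.self_mem_subformulas])
    have hs (w) : M.Sat (s.toWorld w) (.release a b) ↔ M.Sat (s.toWorld w) b ∧
        (M.Sat (s.toWorld w) a ∨ M.Sat (s.toWorld (s.model.succ w)) (.release a b)) := by
      obtain ⟨y, hy, hy'⟩ := s.sensible w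
      rw [← Model.sat_iff_of_label_eq hy h, ← Model.sat_iff_of_label_eq hy ha,
        ← Model.sat_iff_of_label_eq hy hb, ← Model.sat_iff_of_label_eq hy' h,
        Model.sat_release_iff]
    rw [Model.Sat]
    simp only [iha ha, ihb hb]
    constructor
    · intro hw
      by_contra hn
      obtain ⟨j, hj⟩ := s.exists_fulfilled_of_pending hσ h hn
      replace hj : ¬ M.Sat (s.toWorld (s.model.succ^[j] w)) b := hj
      -- Fulfilment only makes `b` fail at step `j`. That `a` does not release it earlier comes from
      -- the unfolding, since `b` together with `a` would make the whole formula true.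
      induction j generalizing w with
      | zero => rcases hw 0 with h0 | ⟨i, hi, -⟩; exacts [hj h0, by omega]
      | succ j ih =>
        have hwb : M.Sat (s.toWorld w) b := by simpa using hw 0
        have hn' := fun h' => hn ((hs w).2 ⟨hwb, h'⟩)
        refine ih _ (fun n => ?_) (fun h' => hn' (.inr h')) hj
        rcases hw (n + 1) with h1 | ⟨_ | i, hi, h1⟩
        · exact .inl h1
        · exact absurd (.inl h1) hn'
        · exact .inr ⟨i, by omega, h1⟩
    · intro hw j
      induction j generalizing w with
      | zero => exact .inl ((hs w).1 hw).1
      | succ j ih =>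
        rcases ((hs w).1 hw).2 with h1 | h1
        · exact .inr ⟨0, j.succ_pos, h1⟩
        · rcases ih _ h1 with h2 | ⟨i, hi, h2⟩
          · exact .inl h2
          · exact .inr ⟨i + 1, by omega, h2⟩
  | _ a b iha ihb =>
    intro h w
    have ha := hsub h (ψ := a) (by simp [Formula.subformulas, a.self_mem_subformulas])
    have hb := hsub h (ψ := b) (by simp [Formula.subformulas, b.self_mem_subformulas])
    have hs (w) : M.Sat (s.toWorld w) (.until a b) ↔ M.Sat (s.toWorld w) b ∨
        M.Sat (s.toWorld w) a ∧ M.Sat (s.toWorld (s.model.succ w)) (.until a b) := by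
      obtain ⟨y, hy, hy'⟩ := s.sensible w
      rw [← Model.sat_iff_of_label_eq hy h, ← Model.sat_iff_of_label_eq hy ha,
        ← Model.sat_iff_of_label_eq hy hb, ← Model.sat_iff_of_label_eq hy' h, Model.sat_until_iff]
    rw [Model.Sat]
    simp only [iha ha, ihb hb]
    constructor
    · rintro ⟨j, hj, hi⟩
      induction j generalizing w with
      | zero => exact (hs w).2 (.inl hj)
      | succ j ih =>
        exact (hs w).2 (.inr ⟨hi 0 j.succ_pos, ih _ hj fun i hij => hi (i + 1) (by omega)⟩)
    · intro hw
      obtain ⟨j, hj⟩ := s.exists_fulfilled_of_pending hσ h hw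
      replace hj : M.Sat (s.toWorld (s.model.succ^[j] w)) b := hj
      induction j generalizing w with
      | zero => exact ⟨0, hj, by simp⟩
      | succ j ih =>
        rcases (hs w).1 hw with hw' | ⟨hwa, hw'⟩
        · exact ⟨0, hw', by simp⟩
        · obtain ⟨n, hn, hi⟩ := ih _ hw' hj
          refine ⟨n + 1, hn, ?_⟩
          rintro (_ | i) hin
          · exact hwa
          · exact hi i (by omega)

end Strategy

end Cover

end ITL

namespace ITL

variable {P : Type v}

/-! ### Tree types, branches and operations on chains -/

/-- The finite types of labelled trees of bounded height, up to bisimulation. -/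
def TreeType (k : ℕ) : ℕ → Type
  | 0 => Set (Fin k)
  | i + 1 => Set (Fin k) × Set (TreeType k i)

namespace Model

variable (M : Model.{u, v} P) {k : ℕ} (σ : Fin k → Formula P)

/-- The type of height `i` of a world. -/
def treeType : (i : ℕ) → M.World → TreeType k i
  | 0, x => M.label σ x
  | i + 1, x => (M.label σ x, {τ | ∃ y, x ≤ y ∧ treeType i y = τ})

open Classical in
/-- A chosen world of type `τ` above `x`. -/
noncomputable def select (i : ℕ) (x : M.World) (τ : TreeType k i) : M.World :=
  if h : ∃ y, x ≤ y ∧ M.treeType σ i y = τ then h.choose else x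

/-- `l` is a chain above `x` along which labels increase strictly. -/
def Strict : M.World → List M.World → Prop
  | _, [] => True
  | x, y :: l => x ≤ y ∧ M.label σ x ≠ M.label σ y ∧ Strict y l

/-- `l` is a strict chain above `x` of selected worlds. -/
def IsBranch : ℕ → M.World → List M.World → Prop
  | _, _, [] => True
  | 0, _, _ :: _ => False
  | i + 1, x, y :: l => x ≤ y ∧ M.label σ x ≠ M.label σ y ∧
      M.select σ i x (M.treeType σ i y) = y ∧ IsBranch i y l

/-- The branch above `x` with the same types as a given chain. -/
noncomputable def retarget : ℕ → M.World → List M.World → List M.World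
  | i + 1, x, z :: l => M.select σ i x (M.treeType σ i z) ::
      retarget i (M.select σ i x (M.treeType σ i z)) l
  | _, _, _ => []

open Classical in
/-- Send a branch `e` above `m` to a chain above `z` of the same types that follows the chain `l`
as long as `e` follows the branch corresponding to `l`. -/
noncomputable def track : ℕ → M.World → M.World → List M.World → List M.World → List M.World
  | i + 1, m, z, z' :: l, e' :: e =>
      if e' = M.select σ i m (M.treeType σ i z') then z' :: track i e' z' l e
      else M.retarget σ (i + 1) z (e' :: e)
  | i, _, z, _, e => M.retarget σ i z e

open Classical in
/-- Remove from a chain above `x` the repetitions of labels. -/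
noncomputable def compress : M.World → List M.World → List M.World
  | _, [] => []
  | x, z :: l => if M.label σ x = M.label σ z then compress x l else z :: compress z l

variable {M σ}

theorem label_eq_of_treeType_eq {i : ℕ} {x y : M.World}
    (h : M.treeType σ i x = M.treeType σ i y) : M.label σ x = M.label σ y := by
  cases i with
  | zero => exact h
  | succ i => exact (Prod.ext_iff.1 h).1

theorem select_spec {i : ℕ} {x z : M.World}
    (h : ∃ y, x ≤ y ∧ M.treeType σ i y = M.treeType σ i z) :
    x ≤ M.select σ i x (M.treeType σ i z) ∧
      M.treeType σ i (M.select σ i x (M.treeType σ i z)) = M.treeType σ i z := by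
  unfold select
  rw [dif_pos h]
  exact h.choose_spec

/-- The back-and-forth step: a type of height `i + 1` records which types of height `i` occur above.
-/
theorem select_spec_of_treeType_eq {i : ℕ} {x y z : M.World}
    (h : M.treeType σ (i + 1) x = M.treeType σ (i + 1) y) (hz : y ≤ z) :
    x ≤ M.select σ i x (M.treeType σ i z) ∧
      M.treeType σ i (M.select σ i x (M.treeType σ i z)) = M.treeType σ i z := by
  refine select_spec ?_
  have : M.treeType σ i z ∈ {τ | ∃ y', x ≤ y' ∧ M.treeType σ i y' = τ} := by
    change M.treeType σ i z ∈ (M.treeType σ (i + 1) x).2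
    rw [h]
    exact ⟨z, hz, rfl⟩
  exact this

theorem IsBranch.strict {i : ℕ} {x : M.World} {l : List M.World} (h : M.IsBranch σ i x l) :
    M.Strict σ x l := by
  induction l generalizing i x with
  | nil => trivial
  | cons y l ih =>
    cases i with
    | zero => exact h.elim
    | succ i => exact ⟨h.1, h.2.1, ih h.2.2.2⟩

theorem IsBranch.length_le {i : ℕ} {x : M.World} {l : List M.World} (h : M.IsBranch σ i x l) :
    l.length ≤ i := by
  induction l generalizing i x with
  | nil => simp
  | cons y l ih =>
    cases i with
    | zero => exact h.elim
    | succ i => simpa using ih h.2.2.2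

/-- Every step of the chain adds an element to a subset of `Fin k`. This is why types of height `k`
suffice. -/
theorem Strict.length_add_ncard_le {x : M.World} {l : List M.World} (h : M.Strict σ x l) :
    l.length + (M.label σ x).ncard ≤ k := by
  induction l generalizing x with
  | nil => simpa using Set.ncard_le_card (M.label σ x)
  | cons y l ih =>
    have h1 : (M.label σ x).ncard < (M.label σ y).ncard :=
      Set.ncard_lt_ncard ((label_mono h.1).ssubset_of_ne h.2.1) (Set.toFinite _)
    have := ih h.2.2
    simp only [List.length_cons]
    omega

theorem Strict.length_le {x : M.World} {l : List M.World} (h : M.Strict σ x l) : l.length ≤ k :=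
  le_of_add_le_left h.length_add_ncard_le

theorem Strict.le_getLastD {x : M.World} {l : List M.World} (h : M.Strict σ x l) :
    x ≤ l.getLastD x := by
  induction l generalizing x with
  | nil => exact le_rfl
  | cons y l ih => rw [List.getLastD_cons]; exact h.1.trans (ih h.2.2)

theorem Strict.concat {x z : M.World} {l : List M.World} (h : M.Strict σ x l)
    (hz : l.getLastD x ≤ z) (hne : M.label σ (l.getLastD x) ≠ M.label σ z) :
    M.Strict σ x (l ++ [z]) := by
  induction l generalizing x with
  | nil => exact ⟨hz, hne, trivial⟩
  | cons y l ih =>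
    rw [List.getLastD_cons] at hz hne
    exact ⟨h.1, h.2.1, ih h.2.2 hz hne⟩

theorem Strict.of_prefix_getLastD_le {x : M.World} {l l' : List M.World} (h : M.Strict σ x l')
    (hl : l <+: l') : l.getLastD x ≤ l'.getLastD x := by
  induction l generalizing x l' with
  | nil => exact h.le_getLastD
  | cons y l ih =>
    cases l' with
    | nil => simp at hl
    | cons y' l' =>
      obtain ⟨rfl, hl'⟩ := List.cons_prefix_cons.1 hl
      simp only [List.getLastD_cons]
      exact ih h.2.2 hl'

theorem IsBranch.exists_concat {i : ℕ} {x z : M.World} {l : List M.World}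
    (h : M.IsBranch σ i x l) (hi : l.length < i) (hz : l.getLastD x ≤ z)
    (hne : M.label σ (l.getLastD x) ≠ M.label σ z) :
    ∃ y, M.IsBranch σ i x (l ++ [y]) ∧ M.label σ y = M.label σ z := by
  induction l generalizing i x with
  | nil =>
    cases i with
    | zero => simp at hi
    | succ i =>
      obtain ⟨h1, h2⟩ := select_spec (i := i) ⟨z, hz, rfl⟩
      have h3 := label_eq_of_treeType_eq h2
      exact ⟨_, ⟨h1, h3 ▸ hne, congrArg _ h2, by cases i <;> trivial⟩, h3⟩
  | cons y l ih =>
    cases i with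
    | zero => exact h.elim
    | succ i =>
      rw [List.getLastD_cons] at hz hne
      obtain ⟨z', hz', e⟩ := ih h.2.2.2 (by simpa using hi) hz hne
      exact ⟨z', ⟨h.1, h.2.1, h.2.2.1, hz'⟩, e⟩

theorem retarget_nil (i : ℕ) (x : M.World) : M.retarget σ i x [] = [] := by
  cases i <;> rfl

/-- Each back-and-forth step costs one unit of height, so a chain of length at most `i` can be
copied in full. -/
theorem Strict.retarget {i : ℕ} {x m : M.World} {l : List M.World} (hl : M.Strict σ x l)
    (h : M.treeType σ i m = M.treeType σ i x) (hi : l.length ≤ i) :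
    M.IsBranch σ i m (M.retarget σ i m l) ∧
      M.label σ ((M.retarget σ i m l).getLastD m) = M.label σ (l.getLastD x) := by
  induction l generalizing i x m with
  | nil =>
    rw [retarget_nil]
    exact ⟨by cases i <;> trivial, label_eq_of_treeType_eq h⟩
  | cons z l ih =>
    cases i with
    | zero => simp at hi
    | succ i =>
      obtain ⟨h1, h2⟩ := select_spec_of_treeType_eq h hl.1
      obtain ⟨h3, h4⟩ := ih hl.2.2 h2 (by simpa using hi)
      simp only [Model.retarget, List.getLastD_cons]
      refine ⟨⟨h1, ?_, congrArg _ h2, h3⟩, h4⟩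
      rw [label_eq_of_treeType_eq h, label_eq_of_treeType_eq h2]
      exact hl.2.1

theorem IsBranch.retarget_eq {i : ℕ} {x : M.World} {l : List M.World} (h : M.IsBranch σ i x l) :
    M.retarget σ i x l = l := by
  induction l generalizing i x with
  | nil => exact retarget_nil i x
  | cons y l ih =>
    cases i with
    | zero => exact h.elim
    | succ i => rw [retarget, h.2.2.1, ih h.2.2.2]

theorem retarget_prefix (i : ℕ) (x : M.World) {l l' : List M.World} (h : l <+: l') :
    M.retarget σ i x l <+: M.retarget σ i x l' := by
  induction l generalizing i x l' with
  | nil => rw [retarget_nil]; exact List.nil_prefix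
  | cons y l ih =>
    cases l' with
    | nil => simp at h
    | cons y' l' =>
      obtain ⟨rfl, h'⟩ := List.cons_prefix_cons.1 h
      cases i with
      | zero => exact List.prefix_rfl
      | succ i => exact List.cons_prefix_cons.2 ⟨rfl, ih i _ h'⟩

theorem track_nil_left (i : ℕ) (m z : M.World) (e : List M.World) :
    M.track σ i m z [] e = M.retarget σ i z e := by
  cases i <;> cases e <;> rfl

theorem track_nil_right (i : ℕ) (m z : M.World) (l : List M.World) :
    M.track σ i m z l [] = [] := by
  cases i <;> cases l <;> rfl

theorem IsBranch.track {i : ℕ} {m z : M.World} {l e : List M.World} (he : M.IsBranch σ i m e)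
    (h : M.treeType σ i m = M.treeType σ i z) (hl : M.Strict σ z l) :
    M.Strict σ z (M.track σ i m z l e) ∧
      M.label σ ((M.track σ i m z l e).getLastD z) = M.label σ (e.getLastD m) := by
  have hret : M.Strict σ z (M.retarget σ i z e) ∧
      M.label σ ((M.retarget σ i z e).getLastD z) = M.label σ (e.getLastD m) :=
    (he.strict.retarget h.symm he.length_le).imp_left IsBranch.strict
  induction l generalizing i m z e with
  | nil => rwa [track_nil_left]
  | cons z' l ih =>
    cases i with
    | zero => cases e <;> exact hret
    | succ i =>
      cases e with
      | nil => rw [track_nil_right]; exact ⟨trivial, (label_eq_of_treeType_eq h).symm⟩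
      | cons e' e =>
        rw [Model.track]
        split_ifs with hs
        · have h2 := (select_spec_of_treeType_eq h hl.1).2
          rw [← hs] at h2
          obtain ⟨h3, h4⟩ := ih he.2.2.2 h2 hl.2.2
            ((he.2.2.2.strict.retarget h2.symm he.2.2.2.length_le).imp_left IsBranch.strict)
          simp only [List.getLastD_cons]
          exact ⟨⟨hl.1, hl.2.1, h3⟩, h4⟩
        · exact hret

theorem track_prefix (i : ℕ) (m z : M.World) (l : List M.World) {e e' : List M.World}
    (h : e <+: e') : M.track σ i m z l e <+: M.track σ i m z l e' := by
  induction l generalizing i m z e e' with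
  | nil => simpa only [track_nil_left] using retarget_prefix i z h
  | cons z' l ih =>
    cases i with
    | zero => cases e <;> cases e' <;> exact List.prefix_rfl
    | succ i =>
      cases e with
      | nil => rw [track_nil_right]; exact List.nil_prefix
      | cons y e =>
        cases e' with
        | nil => simp at h
        | cons y' e' =>
          obtain ⟨rfl, h'⟩ := List.cons_prefix_cons.1 h
          rw [track, track]
          split_ifs
          · exact List.cons_prefix_cons.2 ⟨rfl, ih i _ _ h'⟩
          · exact retarget_prefix _ _ h

/-- The purpose of `track`: the branch that copies `l` is sent back to `l` itself, not just to a
chain of the same types. -/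
theorem track_retarget {i : ℕ} (m z : M.World) {l : List M.World} (hi : l.length ≤ i) :
    M.track σ i m z l (M.retarget σ i m l) = l := by
  induction l generalizing i m z with
  | nil => rw [retarget_nil, track_nil_left, retarget_nil]
  | cons z' l ih =>
    cases i with
    | zero => simp at hi
    | succ i => rw [retarget, track, if_pos rfl, ih _ _ (by simpa using hi)]

/-- When a world is dropped, the base of the remaining chain stays lower down with the same label;
hence the induction needs a base `y` below `M.succ x`. -/
theorem Strict.compress_map_succ {x : M.World} {l : List M.World} (hl : M.Strict σ x l)
    {y : M.World} (hy : y ≤ M.succ x) (he : M.label σ y = M.label σ (M.succ x)) :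
    M.Strict σ y (M.compress σ y (l.map M.succ)) ∧
      M.label σ ((M.compress σ y (l.map M.succ)).getLastD y) =
        M.label σ (M.succ (l.getLastD x)) := by
  induction l generalizing x y with
  | nil => exact ⟨trivial, he⟩
  | cons z l ih =>
    have hz := M.confluent _ _ hl.1
    rw [List.map_cons, compress, List.getLastD_cons]
    split_ifs with h
    · exact ih hl.2.2 (hy.trans hz) h
    · obtain ⟨h1, h2⟩ := ih hl.2.2 le_rfl rfl
      rw [List.getLastD_cons]
      exact ⟨⟨hy.trans hz, h, h1⟩, h2⟩

theorem compress_prefix (x : M.World) {l l' : List M.World} (h : l <+: l') :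
    M.compress σ x l <+: M.compress σ x l' := by
  induction l generalizing x l' with
  | nil => exact List.nil_prefix
  | cons y l ih =>
    cases l' with
    | nil => simp at h
    | cons y' l' =>
      obtain ⟨rfl, h'⟩ := List.cons_prefix_cons.1 h
      rw [compress, compress]
      split_ifs
      · exact ih _ h'
      · exact List.cons_prefix_cons.2 ⟨rfl, ih _ h'⟩

theorem length_compress_le (x : M.World) (l : List M.World) :
    (M.compress σ x l).length ≤ l.length := by
  induction l generalizing x with
  | nil => exact le_rfl
  | cons y l ih =>
    rw [compress]
    split_ifs
    · exact (ih x).trans (Nat.le_succ _)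
    · exact Nat.succ_le_succ (ih y)

theorem compress_eq_of_length_eq {x : M.World} {l : List M.World}
    (h : (M.compress σ x l).length = l.length) : M.compress σ x l = l := by
  induction l generalizing x with
  | nil => rfl
  | cons y l ih =>
    rw [compress] at h ⊢
    split_ifs at h ⊢
    · have := length_compress_le (σ := σ) x l
      simp only [List.length_cons] at h
      omega
    · rw [ih (by simpa using h)]

/-! ### The cover by trees of branches and its fairness -/

variable (M σ)

/-- A chosen representative of the worlds of the same type as `x`. -/
noncomputable def representative (x : M.World) : M.World :=
  (⟨x, rfl⟩ : ∃ y, M.treeType σ k y = M.treeType σ k x).choose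

/-- The trees of branches above the representatives. -/
def treeCover : Cover M σ where
  Obj := Set.range (M.representative σ)
  Node m := {l : List M.World // M.IsBranch σ k m l}
  order m :=
    { le := fun d e => d.1 <+: e.1
      lt := fun d e => d.1 <+: e.1 ∧ ¬ e.1 <+: d.1
      lt_iff_le_not_ge := fun _ _ => Iff.rfl
      le_refl := fun d => List.prefix_rfl
      le_trans := fun _ _ _ => List.IsPrefix.trans
      le_antisymm := fun d e h h' =>
        Subtype.ext (h.eq_of_length (h.length_le.antisymm h'.length_le)) }
  pt {m} d := d.1.getLastD m
  pt_mono {_ d e} h := label_mono (e.2.strict.of_prefix_getLastD_le h)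
  witness {m} d z hz := by
    by_cases h : M.label σ (d.1.getLastD m) = M.label σ z
    · exact ⟨d, List.prefix_rfl, h⟩
    -- Adding `z` still gives a strict chain, so the branch is shorter than `k` and there is height
    -- left to extend it.
    · have h1 := (d.2.strict.concat hz h).length_le
      rw [List.length_append] at h1
      obtain ⟨y, hy, e⟩ := d.2.exists_concat h1 hz h
      exact ⟨⟨_, hy⟩, List.prefix_append _ _, by rwa [List.getLastD_concat]⟩

variable {M σ}

theorem treeType_representative (x : M.World) :
    M.treeType σ k (M.representative σ x) = M.treeType σ k x :=
  (⟨x, rfl⟩ : ∃ y, M.treeType σ k y = M.treeType σ k x).choose_spec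

theorem representative_eq {x y : M.World} (h : M.treeType σ k x = M.treeType σ k y) :
    M.representative σ x = M.representative σ y := by
  unfold representative
  simp only [h]

theorem Strict.compress_spec {z : M.World} {l : List M.World} (hl : M.Strict σ z l) :
    M.Strict σ (M.succ z) (M.compress σ (M.succ z) (l.map M.succ)) ∧
      M.label σ ((M.compress σ (M.succ z) (l.map M.succ)).getLastD (M.succ z)) =
        M.label σ (M.succ (l.getLastD z)) :=
  hl.compress_map_succ le_rfl rfl

/-- The homomorphism of trees induced by the successor function and a tracked chain. -/
noncomputable def treeHom {m m' : (M.treeCover σ).Obj} {z : M.World}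
    (h : M.treeType σ k m.1 = M.treeType σ k z)
    (h' : M.treeType σ k m'.1 = M.treeType σ k (M.succ z)) {l : List M.World}
    (hl : M.Strict σ z l) : (M.treeCover σ).Hom m m' where
  toFun d := ⟨M.retarget σ k m'.1 (M.compress σ (M.succ z) ((M.track σ k m.1 z l d.1).map M.succ)),
    have hs := (d.2.track h hl).1.compress_spec.1
    (hs.retarget h' hs.length_le).1⟩
  mono h := retarget_prefix _ _ (compress_prefix _ ((track_prefix _ _ _ _ h).map _))
  sensible d := by
    obtain ⟨h1, h2⟩ := d.2.track h hl
    obtain ⟨h3, h4⟩ := h1.compress_spec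
    -- The world of `M` behind this node is the end of the tracked chain.
    exact ⟨_, h2, h4.symm.trans (h3.retarget h' h3.length_le).2.symm⟩

/-- Follow the chain `l` of `M` that the branch copies, applying the successor to all of it at once.
The induction is lexicographic, on the length of the chain and then on the number `n` of steps until
its end fulfils the eventuality. -/
theorem treeCover_reach (hσ : ClosedFamily σ) (i : Fin k) (N : ℕ) :
    ∀ (n : ℕ) (m : (M.treeCover σ).Obj) (z : M.World) (l : List M.World)
      (h : M.treeType σ k m.1 = M.treeType σ k z) (hl : M.Strict σ z l), l.length = N →
      M.Pending (σ i) (l.getLastD z) → M.Fulfilled (σ i) (M.succ^[n] (l.getLastD z)) →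
      (M.treeCover σ).Reach i m ⟨M.retarget σ k m.1 l, (hl.retarget h hl.length_le).1⟩ := by
  induction N using Nat.strong_induction_on with
  | _ N ihN =>
    intro n
    induction n with
    | zero =>
      intro m z l h hl _ _ hf
      exact .now ((fulfilled_iff_of_label_eq hσ (hl.retarget h hl.length_le).2 i).2 hf)
    | succ n ihn =>
      intro m z l h hl hN hp hf
      by_cases hf' : M.Fulfilled (σ i) (l.getLastD z)
      · exact .now ((fulfilled_iff_of_label_eq hσ (hl.retarget h hl.length_le).2 i).2 hf')
      have h' := treeType_representative (σ := σ) (M.succ z)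
      let m' : (M.treeCover σ).Obj := ⟨M.representative σ (M.succ z), Set.mem_range_self _⟩
      refine .step (m' := m') (treeHom h h' hl) ?_
      obtain ⟨h1, h2⟩ := hl.compress_spec
      have hp' : M.Pending (σ i)
          ((M.compress σ (M.succ z) (l.map M.succ)).getLastD (M.succ z)) :=
        (pending_iff_of_label_eq h2 i).2 (hp.step.resolve_left hf')
      have key : (M.treeCover σ).Reach i m'
          ⟨M.retarget σ k m'.1 (M.compress σ (M.succ z) (l.map M.succ)),
            (h1.retarget h' h1.length_le).1⟩ := by
        have hle := length_compress_le (σ := σ) (M.succ z) (l.map M.succ)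
        rw [List.length_map, hN] at hle
        rcases hle.lt_or_eq with hlt | heq
        -- Labels collapsed, so the new end need not be the successor of the old one. The
        -- eventuality is still pending there; a new waiting time is affordable because the chain is
        -- shorter.
        · obtain ⟨j, hj⟩ := hp'.exists_fulfilled
          exact ihN _ hlt j m' _ _ h' h1 rfl hp' hj
        · refine ihn m' _ _ h' h1 heq hp' ?_
          -- Nothing collapsed, so the end is the actual successor and one step less remains.
          rw [compress_eq_of_length_eq (by rw [heq, List.length_map, hN]), List.getLastD_map]
          exact hf
      have e : (treeHom h h' hl).toFun ⟨M.retarget σ k m.1 l, (hl.retarget h hl.length_le).1⟩ =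
          (⟨M.retarget σ k m'.1 (M.compress σ (M.succ z) (l.map M.succ)),
            (h1.retarget h' h1.length_le).1⟩ : (M.treeCover σ).Node m') :=
        Subtype.ext (congrArg
          (fun t : List M.World => M.retarget σ k m'.1 (M.compress σ (M.succ z) (t.map M.succ)))
          (track_retarget (σ := σ) m.1 z hl.length_le))
      exact e ▸ key

theorem fair_treeCover (hσ : ClosedFamily σ) : (M.treeCover σ).Fair where
  exists_hom m := ⟨⟨M.representative σ (M.succ m.1), Set.mem_range_self _⟩,
    ⟨treeHom (z := m.1) rfl (treeType_representative _) (l := []) trivial⟩⟩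
  reach {m} d i h := by
    obtain ⟨n, hn⟩ := h.exists_fulfilled
    have hr := treeCover_reach hσ i _ n m m.1 d.1 rfl d.2.strict rfl h hn
    have e : (⟨M.retarget σ k m.1 d.1, (d.2.strict.retarget rfl d.2.strict.length_le).1⟩ :
        (M.treeCover σ).Node m) = d := Subtype.ext d.2.retarget_eq
    exact e ▸ hr

end Model

end ITL

namespace ITL

variable {P : Type v}

/-! ### Primitive recursive bounds and counting -/

/-- The number of tree types of height `i` over `k` formulas. -/
def treeTypeCard (k : ℕ) : ℕ → ℕ :=
  Nat.rec (2 ^ k) fun _ c => 2 ^ k * 2 ^ c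

/-- A bound on the number of branches of length at most `i`. -/
def branchBound (k : ℕ) : ℕ → ℕ :=
  Nat.rec 1 fun i b => treeTypeCard k i * b + 1

/-- A bound on the size of the models built from `k` formulas. -/
def modelBound (k : ℕ) : ℕ :=
  treeTypeCard k k * 2 ^ (branchBound k k * k) * branchBound k k

theorem primrec₂_pow : Primrec₂ ((· ^ ·) : ℕ → ℕ → ℕ) :=
  Primrec₂.unpaired'.1 Nat.Primrec.pow

theorem primrec₂_treeTypeCard : Primrec₂ treeTypeCard := by
  have h2 : Primrec fun x : (ℕ × ℕ) × ℕ × ℕ => 2 ^ x.1.1 * 2 ^ x.2.2 :=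
    Primrec.nat_mul.comp
      (primrec₂_pow.comp (Primrec.const 2) (Primrec.fst.comp Primrec.fst))
      (primrec₂_pow.comp (Primrec.const 2) (Primrec.snd.comp Primrec.snd))
  exact Primrec.nat_rec' (f := fun x : ℕ × ℕ => x.2) (g := fun x => 2 ^ x.1)
    (h := fun x y => 2 ^ x.1 * 2 ^ y.2) Primrec.snd
    (primrec₂_pow.comp (Primrec.const 2) Primrec.fst) h2

theorem primrec₂_branchBound : Primrec₂ branchBound := by
  have h2 : Primrec fun x : (ℕ × ℕ) × ℕ × ℕ => treeTypeCard x.1.1 x.2.1 * x.2.2 + 1 :=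
    Primrec.succ.comp (Primrec.nat_mul.comp
      (primrec₂_treeTypeCard.comp (Primrec.fst.comp Primrec.fst) (Primrec.fst.comp Primrec.snd))
      (Primrec.snd.comp Primrec.snd))
  exact Primrec.nat_rec' (f := fun x : ℕ × ℕ => x.2) (g := fun _ => 1)
    (h := fun x y => treeTypeCard x.1 y.1 * y.2 + 1) Primrec.snd (Primrec.const 1) h2

theorem primrec_modelBound : Primrec modelBound := by
  have hb : Primrec fun k => branchBound k k := primrec₂_branchBound.comp Primrec.id Primrec.id
  exact Primrec.nat_mul.comp (Primrec.nat_mul.comp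
    (primrec₂_treeTypeCard.comp Primrec.id Primrec.id)
    (primrec₂_pow.comp (Primrec.const 2) (Primrec.nat_mul.comp hb Primrec.id))) hb

theorem card_set_eq (α : Type*) [Finite α] : Nat.card (Set α) = 2 ^ Nat.card α := by
  have := Fintype.ofFinite α
  simp [Nat.card_eq_fintype_card]

theorem card_sigma_le {α : Type*} {β : α → Type*} [Finite α] [∀ a, Finite (β a)] {n : ℕ}
    (h : ∀ a, Nat.card (β a) ≤ n) : Nat.card (Sigma β) ≤ Nat.card α * n := by
  have := Fintype.ofFinite α
  rw [Nat.card_sigma, Nat.card_eq_fintype_card]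
  exact (Finset.sum_le_card_nsmul _ _ n fun a _ => h a).trans (by simp)

instance finite_treeType (k i : ℕ) : Finite (TreeType k i) := by
  induction i with
  | zero => exact inferInstanceAs (Finite (Set (Fin k)))
  | succ i ih => exact inferInstanceAs (Finite (Set (Fin k) × Set (TreeType k i)))

theorem card_treeType (k i : ℕ) : Nat.card (TreeType k i) = treeTypeCard k i := by
  induction i with
  | zero => exact (card_set_eq (Fin k)).trans (by rw [Nat.card_fin]; rfl)
  | succ i ih =>
    refine (Nat.card_prod (Set (Fin k)) (Set (TreeType k i))).trans ?_
    rw [card_set_eq, card_set_eq, ih, Nat.card_fin]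
    rfl

/-- Codes of branches: sequences of tree types of decreasing height. -/
def BranchCode (k : ℕ) : ℕ → Type
  | 0 => Unit
  | i + 1 => Option (TreeType k i × BranchCode k i)

instance finite_branchCode (k i : ℕ) : Finite (BranchCode k i) := by
  induction i with
  | zero => exact inferInstanceAs (Finite Unit)
  | succ i ih => exact inferInstanceAs (Finite (Option (TreeType k i × BranchCode k i)))

theorem card_branchCode (k i : ℕ) : Nat.card (BranchCode k i) = branchBound k i := by
  induction i with
  | zero => exact Nat.card_unique (α := Unit)
  | succ i ih =>
    refine (Finite.card_option (α := TreeType k i × BranchCode k i)).trans ?_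
    rw [Nat.card_prod, card_treeType, ih]
    rfl

namespace Model

variable {M : Model.{u, v} P} {k : ℕ} {σ : Fin k → Formula P}

variable (M σ) in
/-- The types of the worlds of a branch. -/
def branchCode : (i : ℕ) → List M.World → BranchCode k i
  | 0, _ => ()
  | _ + 1, [] => none
  | i + 1, y :: l => some (M.treeType σ i y, branchCode i l)

/-- Each world of a branch is the one selected for its type above its predecessor, so the types
determine the worlds. -/
theorem IsBranch.eq_of_branchCode_eq {i : ℕ} {x : M.World} {l l' : List M.World}
    (h : M.IsBranch σ i x l) (h' : M.IsBranch σ i x l')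
    (e : M.branchCode σ i l = M.branchCode σ i l') : l = l' := by
  induction i generalizing x l l' with
  | zero =>
    cases l with
    | nil =>
      cases l' with
      | nil => rfl
      | cons => exact h'.elim
    | cons => exact h.elim
  | succ i ih =>
    cases l with
    | nil =>
      cases l' with
      | nil => rfl
      | cons => exact absurd e (Option.some_ne_none _).symm
    | cons y l =>
      cases l' with
      | nil => exact absurd e (Option.some_ne_none _)
      | cons y' l' =>
        obtain ⟨h1, h2⟩ := Prod.ext_iff.1 (Option.some.inj e)
        replace h1 : M.treeType σ i y = M.treeType σ i y' := h1
        have hy : y = y' := by rw [← h.2.2.1, h1, h'.2.2.1]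
        subst hy
        rw [ih h.2.2.2 h'.2.2.2 h2]

theorem injective_branchCode (m : (M.treeCover σ).Obj) :
    Function.Injective fun d : (M.treeCover σ).Node m => M.branchCode σ k d.1 :=
  fun d e h => Subtype.ext (d.2.eq_of_branchCode_eq e.2 h)

instance finite_node (m : (M.treeCover σ).Obj) : Finite ((M.treeCover σ).Node m) :=
  Finite.of_injective _ (injective_branchCode m)

theorem card_node_le (m : (M.treeCover σ).Obj) :
    Nat.card ((M.treeCover σ).Node m) ≤ branchBound k k :=
  (Nat.card_le_card_of_injective _ (injective_branchCode m)).trans (card_branchCode k k).le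

theorem injective_treeType_obj :
    Function.Injective fun m : (M.treeCover σ).Obj => M.treeType σ k m.1 := by
  rintro ⟨_, x, rfl⟩ ⟨_, y, rfl⟩ h
  simp only [treeType_representative] at h
  exact Subtype.ext (representative_eq h)

instance finite_obj : Finite (M.treeCover σ).Obj :=
  Finite.of_injective _ injective_treeType_obj

theorem card_obj_le : Nat.card (M.treeCover σ).Obj ≤ treeTypeCard k k :=
  (Nat.card_le_card_of_injective _ injective_treeType_obj).trans (card_treeType k k).le

theorem isBranch_nil (i : ℕ) (x : M.World) : M.IsBranch σ i x [] := by
  cases i <;> trivial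

instance nonempty_node (m : (M.treeCover σ).Obj) : Nonempty ((M.treeCover σ).Node m) :=
  ⟨⟨[], isBranch_nil k m.1⟩⟩

instance nonempty_obj : Nonempty (M.treeCover σ).Obj :=
  ⟨⟨_, Set.mem_range_self (Classical.arbitrary M.World)⟩⟩

theorem card_control_le :
    Nat.card (M.treeCover σ).Control ≤ treeTypeCard k k * 2 ^ (branchBound k k * k) := by
  refine (card_sigma_le fun m => ?_).trans (Nat.mul_le_mul_right _ card_obj_le)
  rw [card_set_eq, Nat.card_prod, Nat.card_fin]
  exact Nat.pow_le_pow_right two_pos (Nat.mul_le_mul_right _ (card_node_le m))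

variable (M) in
/-- The truth of a formula at the worlds of any model is reflected in a finite model of bounded
size. -/
theorem exists_finite_model (φ : Formula P) : ∃ M' : Model.{u, v} P, Finite M'.World ∧
    Nat.card M'.World ≤ modelBound (2 * φ.length + 1) ∧
    ∀ w : M.World, ∃ w' : M'.World, M'.Sat w' φ ↔ M.Sat w φ := by
  have hσ := φ.closedFamily_subformulaFamily
  have hφ := Formula.mem_range_subformulaFamily φ.self_mem_subformulas
  generalize φ.subformulaFamily = σ at hσ hφ
  obtain ⟨s⟩ := (fair_treeCover (M := M) hσ).nonempty_strategy
  refine ⟨s.model,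
    inferInstanceAs (Finite (Σ c : (M.treeCover σ).Control, (M.treeCover σ).Node c.1)),
    ?_, fun w => ?_⟩
  · exact (card_sigma_le fun c : (M.treeCover σ).Control => card_node_le c.1).trans
      (Nat.mul_le_mul_right _ card_control_le)
  · let m : (M.treeCover σ).Obj := ⟨M.representative σ w, Set.mem_range_self w⟩
    -- The root of the tree is labelled by the representative of `w`; no debts are loaded at the
    -- start.
    let d : (M.treeCover σ).Node m := ⟨[], isBranch_nil _ m.1⟩
    refine ⟨⟨⟨m, ∅⟩, d⟩, (s.sat_model_iff hσ φ hφ _).trans ?_⟩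
    exact sat_iff_of_label_eq (label_eq_of_treeType_eq (treeType_representative w)) hφ

end Model

end ITL

/-- The effective finite model property of `ITL^e`: a single computable function bounds, in terms
of the length of a formula, the number of worlds of a model that satisfies (falsifies) it. -/
theorem mainTheorem1 :
    ∃ B : ℕ → ℕ, Computable B ∧
      ∀ (P : Type v) [Countable P] (φ : ITL.Formula P),
        (ITL.Formula.Satisfiable.{u, v} φ ↔
          ∃ M : ITL.Model.{u, v} P,
            Finite M.World ∧ Nat.card M.World ≤ B φ.length ∧ M.Satisfies φ) ∧
        (ITL.Formula.Falsifiable.{u, v} φ ↔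
          ∃ M : ITL.Model.{u, v} P,
            Finite M.World ∧ Nat.card M.World ≤ B φ.length ∧ M.Falsifies φ) := by
  refine ⟨fun n => ITL.modelBound (2 * n + 1), ?_, fun P _ φ => ⟨⟨?_, ?_⟩, ⟨?_, ?_⟩⟩⟩
  · exact (ITL.primrec_modelBound.comp
      (Primrec.succ.comp (Primrec.nat_mul.comp (Primrec.const 2) Primrec.id))).to_comp
  · rintro ⟨M, w, hw⟩
    obtain ⟨M', hfin, hcard, h⟩ := M.exists_finite_model φ
    obtain ⟨w', hw'⟩ := h w
    exact ⟨M', hfin, hcard, w', hw'.2 hw⟩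
  · exact fun ⟨M, _, _, h⟩ => ⟨M, h⟩
  · rintro ⟨M, w, hw⟩
    obtain ⟨M', hfin, hcard, h⟩ := M.exists_finite_model φ
    obtain ⟨w', hw'⟩ := h w
    exact ⟨M', hfin, hcard, w', fun h' => hw (hw'.1 h')⟩
  · exact fun ⟨M, _, _, h⟩ => ⟨M, h⟩
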